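/- The square grid is the graph with vertex set $\mathbb{Z}^2$ in which $\vec u$ and $\vec v$ are adjacent if and only if $\vec u-\vec v\in\{(\pm1,0),(0,\pm1)\}$. Let $r\ge 2$ be an integer, let $b,a$ be non-negative integers, and for $\vec u\in\mathbb{Z}^2$ let $N_r(\vec u)$ be the closed $r$-neighborhood of $\vec u$ in the square grid, that is, the set of vertices at graph distance at most $r$ from $\vec u$. Put $D=N_r(\vec 0)$. (i) Let $c\in\{0,1\}^{\mathbb{Z}^2}$ be a $(D,b,a)$-covering, that is, for every $\vec u\in\mathbb{Z}^2$ the number of $\vec w\in\vec u+D$ with $c_{\vec w}=1$ is exactly $b$ if $c_{\vec u}=1$ and exactly $a$ if $c_{\vec u}=0$. Then $c$ is two-periodic: there are linearly independent $\vec t_1,\vec t_2\in\mathbb{Z}^2$ such that $c_{\vec u-\vec t_i}=c_{\vec u}$ for all $\vec u\in\mathbb{Z}^2$ and $i=1,2$. (ii) In other words, let $S\subseteq\mathbb{Z}^2$ be an $(r,b,a)$-covering in the square grid, that is, for every $\vec u\in\mathbb{Z}^2$ one has $|N_r(\vec u)\cap S|=b$ if $\vec u\in S$ and $|N_r(\vec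 u)\cap S|=a$ if $\vec u\notin S$. Then $S$ is two-periodic: there are linearly independent $\vec t_1,\vec t_2\in\mathbb{Z}^2$ with $S=S+\vec t_1=S+\vec t_2$. -/

import Mathlib

open scoped Pointwise

namespace PerfectCovering

/-- The closed `r`-neighborhood `N_r(u)` of a vertex `u`: all `v` with `d(v, u) ≤ r`, where `d` is
the graph distance (infinite between vertices that are not joined by a path). -/
def closedNeighborhood {V : Type*} (G : SimpleGraph V) (r : ℕ) (u : V) : Set V :=
  {v | G.edist v u ≤ (r : ℕ∞)}

/-- A code `S` in the graph `G` is an `(r, b, a)`-covering if the `r`-neighborhood of every vertex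
in `S` contains exactly `b` elements of `S` and the `r`-neighborhood of every vertex outside `S`
contains exactly `a` elements of `S`. -/
def IsCodeCovering {V : Type*} (G : SimpleGraph V) (r b a : ℕ) (S : Set V) : Prop :=
  ∀ u : V,
    (u ∈ S → (closedNeighborhood G r u ∩ S).encard = (b : ℕ∞)) ∧
    (u ∉ S → (closedNeighborhood G r u ∩ S).encard = (a : ℕ∞))

/-- A two-dimensional configuration over the alphabet `A`. -/
abbrev Configuration (A : Type*) : Type _ := ℤ × ℤ → A

/-- The binary configuration `c` is a `(D, b, a)`-covering if for every cell `u` the pattern of `c`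
on `u + D` contains exactly `b` symbols `1` when `c u = 1` and exactly `a` when `c u = 0`. -/
def IsConfigCovering (D : Set (ℤ × ℤ)) (b a : ℕ) (c : Configuration (Fin 2)) : Prop :=
  ∀ u : ℤ × ℤ,
    (c u = 1 → {w ∈ u +ᵥ D | c w = 1}.encard = (b : ℕ∞)) ∧
    (c u = 0 → {w ∈ u +ᵥ D | c w = 1}.encard = (a : ℕ∞))

/-- The square grid: the graph on `ℤ × ℤ` in which `u` and `v` are adjacent if and only if
`u - v` is one of `(±1, 0)`, `(0, ±1)`. -/
def squareGrid : SimpleGraph (ℤ × ℤ) where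
  Adj u v := u - v ∈ ({(1, 0), (-1, 0), (0, 1), (0, -1)} : Set (ℤ × ℤ))
  symm := ⟨fun u v h => by
    rw [← neg_sub u v]
    simp only [Set.mem_insert_iff, Set.mem_singleton_iff] at h ⊢
    rcases h with h | h | h | h <;> simp [h]⟩
  loopless := ⟨fun u h => by simp [Prod.ext_iff] at h⟩

/-- Translation of a configuration by the vector `t`. -/
def translate {A : Type*} (t : ℤ × ℤ) (c : Configuration A) : Configuration A :=
  fun u => c (u - t)

/-- A configuration is two-periodic if it has two linearly independent vectors of periodicity. -/
def IsTwoPeriodicConfig {A : Type*} (c : Configuration A) : Prop :=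
  ∃ t₁ t₂ : ℤ × ℤ, LinearIndependent ℤ ![t₁, t₂] ∧ translate t₁ c = c ∧ translate t₂ c = c

/-- A code `S` in `ℤ × ℤ` is two-periodic if `S = S + t₁ = S + t₂` for some linearly independent
vectors `t₁` and `t₂`. -/
def IsTwoPeriodicCode (S : Set (ℤ × ℤ)) : Prop :=
  ∃ t₁ t₂ : ℤ × ℤ, LinearIndependent ℤ ![t₁, t₂] ∧ S = t₁ +ᵥ S ∧ S = t₂ +ᵥ S

end PerfectCovering

/-!
Let `e` be the indicator function of a covering. It satisfies a linear equation: the sum of `e` over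
the ball about `z`, minus `(b - a) e z`, is the constant `a` (`IsCodeCovering.solves`). In terms of
the action of Laurent polynomials on functions on `ℤ²`, the polynomial `f` of the ball, with
`b - a` subtracted from its constant term, maps `e` to a constant, and so annihilates every
difference `e (z + v) - e z`.

A bounded integer function annihilated by a Laurent polynomial is annihilated by a product of
binomials `X^v - 1` (`exists_prod_binomial_annihilator`). By Frobenius, dilating the exponents of an
annihilator by a large prime gives an annihilator again, and therefore so does dilating by every
`1 + j N` for a suitable `N`. In the sum of these relations over `j < J` the term with exponent
`u₀` grows like `J`, while all the others telescope under the binomials `X^(N (u - u₀)) - 1`.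

For `r ≥ 2` the polynomial `f` has no factor supported on a line, in the following concrete form: a
bounded solution of the homogeneous equation that vanishes on a wide enough strip, in any rational
direction, is zero (`eq_zero_of_vanishes_on_strip`). If the direction is not that of an edge of the
ball, a unique vertex of the ball is extreme and the equation determines its value. In the direction
of an edge, the two extreme diagonals carry `1 + t + ⋯ + t^r` and `1 + t + ⋯ + t^(r-1)`, which are
coprime; boundedness then forces the solution to vanish (`eq_zero_of_consecutive_lines`).

Hence a solution with one nonzero period `v` is doubly periodic, because modulo `v` a strip carries
only finitely many patterns (`IsBounded.isFullyPeriodic_of_period`). Finally, if the difference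
of a bounded solution in direction `v` is doubly periodic, then a multiple of `v` is a period of the
solution (`IsBounded.isFullyPeriodic_of_diff`), so that the binomials of the annihilator can be
removed one by one.
-/

namespace PerfectCovering
open AddMonoidAlgebra

/-! ### Annihilators of bounded integer functions -/

section Action

/-- The action of the group algebra `R[M]` (for `M = ℤ²`, Laurent polynomials in two variables) on
`R`-valued functions on `M`: the monomial `X^u` sends `e` to `z ↦ e (z + u)`. -/
noncomputable def shiftAction (R : Type*) [CommRing R] (M : Type*) [AddCommGroup M] :
    R[M] →ₐ[R] Module.End R (M → R) :=
  AddMonoidAlgebra.lift R (Module.End R (M → R)) M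
    { toFun := fun u => LinearMap.funLeft R R fun z => z + u.toAdd
      map_one' := by ext; simp [LinearMap.funLeft_apply]
      map_mul' := fun u v => by
        ext
        simp [LinearMap.funLeft_apply, add_comm, add_left_comm] }

variable {M : Type*} [AddCommGroup M]

theorem shiftAction_single {R : Type*} [CommRing R] (u : M) (k : R) (e : M → R) (z : M) :
    shiftAction R M (single u k) e z = k * e (z + u) := by
  simp [shiftAction, LinearMap.funLeft_apply]

theorem shiftAction_sum_single {R : Type*} [CommRing R] {ι : Type*} (s : Finset ι) (u : ι → M)
    (k : ι → R) (e : M → R) (z : M) :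
    shiftAction R M (∑ i ∈ s, single (u i) (k i)) e z = ∑ i ∈ s, k i * e (z + u i) := by
  simp [map_sum, shiftAction_single]

theorem shiftAction_single_sub_one (v : M) (e : M → ℤ) (z : M) :
    shiftAction ℤ M (single v 1 - 1) e z = e (z + v) - e z := by
  simp [shiftAction_single]

/-- An integer-valued function is bounded if its absolute values are at most some constant. -/
def IsBounded (e : M → ℤ) : Prop := ∃ B : ℤ, ∀ z, |e z| ≤ B

theorem IsBounded.shiftAction_apply {e : M → ℤ} (he : IsBounded e) (P : ℤ[M]) :
    IsBounded (shiftAction ℤ M P e) := by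
  induction P using AddMonoidAlgebra.induction_on with
  | of m =>
    obtain ⟨B, hB⟩ := he
    exact ⟨B, fun z => by simpa [of_apply, shiftAction_single] using hB _⟩
  | add x y hx hy =>
    obtain ⟨B, hB⟩ := hx
    obtain ⟨C, hC⟩ := hy
    exact ⟨B + C, fun z => by
      simpa using (abs_add_le _ _).trans (add_le_add (hB z) (hC z))⟩
  | smul r x hx =>
    obtain ⟨B, hB⟩ := hx
    refine ⟨|r| * B, fun z => ?_⟩
    simpa [abs_mul] using mul_le_mul_of_nonneg_left (hB z) (abs_nonneg r)

/-- An integer whose multiples are all bounded by one constant vanishes. -/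
theorem eq_zero_of_forall_nat_mul_abs_le {x C : ℤ} (h : ∀ k : ℕ, |(k : ℤ) * x| ≤ C) : x = 0 := by
  by_contra hx
  have h1 : 1 ≤ |x| := Int.one_le_abs hx
  have h2 := h (C.toNat + 1)
  rw [abs_mul, Nat.abs_cast] at h2
  push_cast at h2
  nlinarith [Int.self_le_toNat C]

/-- A bounded function whose difference in direction `v` is `v`-periodic is itself `v`-periodic. -/
theorem IsBounded.periodic_of_diff_periodic {e : M → ℤ} (he : IsBounded e) {v : M}
    (h : ∀ z, e (z + v + v) - e (z + v) = e (z + v) - e z) (z : M) : e (z + v) = e z := by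
  obtain ⟨B, hB⟩ := he
  have key : ∀ k : ℕ, e (z + k • v + v) - e (z + k • v) = e (z + v) - e z := by
    intro k
    induction k with
    | zero => simp
    | succ k ih => rw [succ_nsmul, ← add_assoc, h, ih]
  have lin : ∀ k : ℕ, e (z + k • v) = e z + k * (e (z + v) - e z) := by
    intro k
    induction k with
    | zero => simp
    | succ k ih =>
      have := key k
      rw [succ_nsmul, ← add_assoc]
      push_cast
      linarith
  have := eq_zero_of_forall_nat_mul_abs_le (x := e (z + v) - e z) (C := B + B) fun k => by
    rw [show (k : ℤ) * (e (z + v) - e z) = e (z + k • v) - e z by rw [lin]; ring]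
    exact (abs_sub _ _).trans (add_le_add (hB _) (hB _))
  linarith

/-- If a Laurent polynomial annihilates an integer function `e`, then dilating its exponents by a
prime `p` gives a polynomial that maps `e` to multiples of `p`: modulo `p` the dilated polynomial is
the `p`-th power of the original one. -/
theorem prime_dvd_dilated_sum {D : Finset M} {k : M → ℤ} {g : M → M} {e : M → ℤ}
    (h : ∀ z, ∑ u ∈ D, k u * e (z + g u) = 0) {p : ℕ} (hp : p.Prime) (z : M) :
    (p : ℤ) ∣ ∑ u ∈ D, k u * e (z + p • g u) := by
  have : Fact p.Prime := ⟨hp⟩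
  have : CharP (ZMod p)[M] p := charP_of_injective_algebraMap
    (FaithfulSMul.algebraMap_injective (ZMod p) (ZMod p)[M]) p
  set F : (ZMod p)[M] := ∑ u ∈ D, single (g u) (k u : ZMod p) with hF
  set E : M → ZMod p := fun z => (e z : ZMod p)
  have h0 : shiftAction (ZMod p) M F E = 0 := by
    ext z
    rw [hF, shiftAction_sum_single]
    have := congrArg (Int.cast : ℤ → ZMod p) (h z)
    push_cast at this
    exact this
  have h1 : F ^ p = ∑ u ∈ D, single (p • g u) (k u : ZMod p) := by
    rw [hF, sum_pow_char]
    exact Finset.sum_congr rfl fun u _ => by rw [single_pow, ZMod.pow_card]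
  have h2 : shiftAction (ZMod p) M (F ^ p) E = 0 := by
    obtain ⟨q, rfl⟩ : ∃ q, p = q + 1 := ⟨p - 1, (Nat.succ_pred_prime hp).symm⟩
    rw [pow_succ, map_mul, Module.End.mul_apply, h0, map_zero]
  rw [← ZMod.intCast_zmod_eq_zero_iff_dvd]
  have := congrFun h2 z
  rw [h1, shiftAction_sum_single] at this
  push_cast
  exact this

/-- Dilation: an annihilator of a bounded integer function stays one when its exponents are
multiplied by any `n` without small prime factors. A prime factor `p` that exceeds all the values
that can occur turns divisibility by `p` into vanishing. -/
theorem exists_dilated_sum_eq_zero {D : Finset M} {k : M → ℤ} {e : M → ℤ} (he : IsBounded e)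
    (h : ∀ z, ∑ u ∈ D, k u * e (z + u) = 0) :
    ∃ N : ℕ, 0 < N ∧ ∀ (j : ℕ) (z : M), ∑ u ∈ D, k u * e (z + (1 + j * N) • u) = 0 := by
  obtain ⟨B, hB⟩ := he
  set C : ℤ := ∑ u ∈ D, |k u| * B
  have hC : ∀ (g : M → M) (z : M), |∑ u ∈ D, k u * e (z + g u)| ≤ C := fun g z =>
    (Finset.abs_sum_le_sum_abs _ _).trans <| Finset.sum_le_sum fun u _ => by
      rw [abs_mul]
      exact mul_le_mul_of_nonneg_left (hB _) (abs_nonneg _)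
  have key : ∀ n : ℕ, n ≠ 0 → (∀ p : ℕ, p.Prime → p ∣ n → C < p) →
      ∀ z, ∑ u ∈ D, k u * e (z + n • u) = 0 := by
    intro n
    induction n using induction_on_primes with
    | zero => exact fun h => absurd rfl h
    | one => exact fun _ _ => by simpa using h
    | prime_mul p a hp ih =>
      intro hn hfac z
      have ha := ih (right_ne_zero_of_mul hn) fun q hq hqa => hfac q hq (hqa.mul_left p)
      have := prime_dvd_dilated_sum (g := fun u => a • u) ha hp z
      simp only [← mul_smul] at this
      exact Int.eq_zero_of_abs_lt_dvd this ((hC _ z).trans_lt (hfac p hp (dvd_mul_right p a)))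
  refine ⟨(C.toNat).factorial, Nat.factorial_pos _, fun j => key _ (by omega) fun p hp hdvd => ?_⟩
  by_contra hle
  have hpC : p ∣ (C.toNat).factorial := (hp.dvd_factorial).2 (by omega)
  exact hp.one_lt.ne' (Nat.dvd_one.1 ((Nat.dvd_add_left (hpC.mul_left j)).1 hdvd))

/-- A bounded integer function annihilated by a Laurent polynomial `∑ k_u X^u` with a nonzero
coefficient at `u₀` is annihilated by the product of the binomials `X^(N (u - u₀)) - 1` for some
`N > 0`. Summing the dilated relations, every term with `u ≠ u₀` telescopes under its binomial, so
that arbitrarily large multiples of the values of the resulting function stay bounded. -/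
theorem exists_prod_binomial_annihilator [DecidableEq M] {D : Finset M} {k : M → ℤ} {e : M → ℤ}
    (he : IsBounded e) (h : ∀ z, ∑ u ∈ D, k u * e (z + u) = 0) {u₀ : M} (hu₀ : u₀ ∈ D)
    (hk : k u₀ ≠ 0) :
    ∃ N : ℕ, 0 < N ∧
      shiftAction ℤ M (∏ u ∈ D.erase u₀, (single (N • (u - u₀)) (1 : ℤ) - 1)) e = 0 := by
  obtain ⟨N, hN, hdil⟩ := exists_dilated_sum_eq_zero he h
  refine ⟨N, hN, ?_⟩
  set T : M → ℤ[M] := fun u => single (N • (u - u₀)) (1 : ℤ) - 1 with hT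
  set F : ℕ → ℤ[M] := fun j => ∑ u ∈ D, single ((1 + j * N) • (u - u₀)) (k u) with hF
  have hF0 : ∀ j, shiftAction ℤ M (F j) e = 0 := fun j => by
    ext z
    rw [hF, shiftAction_sum_single, Pi.zero_apply, ← hdil j (z - (1 + j * N) • u₀)]
    refine Finset.sum_congr rfl fun u _ => ?_
    rw [smul_sub, sub_add_eq_add_sub, add_sub_assoc]
  -- A binomial times the matching progression of monomials telescopes.
  have tele : ∀ (J : ℕ) (u : M), T u * ∑ j ∈ Finset.range J, single ((1 + j * N) • (u - u₀)) (k u)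
      = single ((1 + J * N) • (u - u₀)) (k u) - single (u - u₀) (k u) := by
    intro J u
    induction J with
    | zero => simp
    | succ J ih =>
      rw [Finset.sum_range_succ, mul_add, ih, hT]
      simp only [sub_mul, one_mul, single_mul_single, ← add_smul]
      rw [show N + (1 + J * N) = 1 + (J + 1) * N by ring]
      abel
  set Q : M → ℤ[M] := fun u => ∏ v ∈ (D.erase u₀).erase u, T v with hQ
  have expand : ∀ J : ℕ, (∏ u ∈ D.erase u₀, T u) * ∑ j ∈ Finset.range J, F j =
      single 0 ((J : ℤ) * k u₀) * (∏ u ∈ D.erase u₀, T u) + ∑ u ∈ D.erase u₀,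
        (single ((1 + J * N) • (u - u₀)) (k u) - single (u - u₀) (k u)) * Q u := by
    intro J
    rw [hF, Finset.sum_comm, ← Finset.add_sum_erase _ _ hu₀, mul_add, Finset.mul_sum (D.erase u₀)]
    refine congrArg₂ (· + ·) ?_ (Finset.sum_congr rfl fun u hu => ?_)
    · simp only [sub_self, smul_zero, Finset.sum_const, Finset.card_range, nsmul_eq_mul]
      rw [natCast_def, single_mul_single, add_zero, mul_comm]
    · rw [← tele, ← Finset.mul_prod_erase _ _ hu]
      ring
  choose B hB using fun u => he.shiftAction_apply (Q u)
  ext z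
  have hzero : k u₀ * shiftAction ℤ M (∏ u ∈ D.erase u₀, T u) e z = 0 := by
    refine eq_zero_of_forall_nat_mul_abs_le
      (C := ∑ u ∈ D.erase u₀, (|k u| * B u + |k u| * B u)) fun J => ?_
    have h1 : shiftAction ℤ M ((∏ u ∈ D.erase u₀, T u) * ∑ j ∈ Finset.range J, F j) e z = 0 := by
      rw [map_mul, Module.End.mul_apply, map_sum, LinearMap.sum_apply,
        Finset.sum_eq_zero fun j _ => hF0 j, map_zero, Pi.zero_apply]
    rw [expand] at h1
    simp only [map_add, map_mul, map_sum, map_sub, sub_mul, LinearMap.add_apply,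
      LinearMap.sum_apply, LinearMap.sub_apply, Module.End.mul_apply, Pi.add_apply,
      Finset.sum_apply, Pi.sub_apply, shiftAction_single, add_zero] at h1
    rw [← mul_assoc, eq_neg_of_add_eq_zero_left h1, abs_neg]
    refine (Finset.abs_sum_le_sum_abs _ _).trans (Finset.sum_le_sum fun u _ => ?_)
    refine (abs_sub _ _).trans (add_le_add ?_ ?_) <;> rw [abs_mul] <;>
      exact mul_le_mul_of_nonneg_left (hB _ _) (abs_nonneg _)
  exact (mul_eq_zero.1 hzero).resolve_left hk

end Action

/-! ### Balls of the square grid -/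

/-- The ball of radius `r` about the origin for the `ℓ¹` metric, as a finite set. -/
noncomputable def ball (r : ℕ) : Finset (ℤ × ℤ) :=
  (Finset.Icc (-r : ℤ) r ×ˢ Finset.Icc (-r : ℤ) r).filter fun u => |u.1| + |u.2| ≤ r

theorem mem_ball {r : ℕ} {u : ℤ × ℤ} : u ∈ ball r ↔ |u.1| + |u.2| ≤ r := by
  simp only [ball, Finset.mem_filter, Finset.mem_product, Finset.mem_Icc, and_iff_right_iff_imp]
  intro h
  have h1 := abs_le.1 (show |u.1| ≤ r by linarith [abs_nonneg u.2])
  have h2 := abs_le.1 (show |u.2| ≤ r by linarith [abs_nonneg u.1])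
  exact ⟨h1, h2⟩

theorem squareGrid_adj_iff {u v : ℤ × ℤ} :
    squareGrid.Adj u v ↔ |u.1 - v.1| + |u.2 - v.2| = 1 := by
  simp only [squareGrid, Set.mem_insert_iff, Set.mem_singleton_iff, Prod.ext_iff, Prod.fst_sub,
    Prod.snd_sub]
  generalize u.1 - v.1 = x
  generalize u.2 - v.2 = y
  rcases abs_cases x with h | h <;> rcases abs_cases y with h' | h' <;> omega

theorem abs_add_abs_le_length {u v : ℤ × ℤ} (p : squareGrid.Walk u v) :
    |u.1 - v.1| + |u.2 - v.2| ≤ p.length := by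
  induction p with
  | nil => simp
  | @cons u v w h p ih =>
    rw [squareGrid_adj_iff] at h
    rw [SimpleGraph.Walk.length_cons]
    push_cast
    linarith [abs_sub_le u.1 v.1 w.1, abs_sub_le u.2 v.2 w.2]

theorem exists_walk_of_abs_add_abs_eq (n : ℕ) (u v : ℤ × ℤ)
    (h : |u.1 - v.1| + |u.2 - v.2| = n) : ∃ p : squareGrid.Walk u v, p.length = n := by
  induction n generalizing u with
  | zero =>
    have h1 : u = v := by
      have := abs_nonneg (u.1 - v.1)
      have := abs_nonneg (u.2 - v.2)
      have h1 : |u.1 - v.1| = 0 := by push_cast at h; omega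
      have h2 : |u.2 - v.2| = 0 := by push_cast at h; omega
      rw [abs_eq_zero, sub_eq_zero] at h1 h2
      exact Prod.ext h1 h2
    subst h1
    exact ⟨.nil, rfl⟩
  | succ n ih =>
    -- One coordinate differs; move it one step closer.
    obtain ⟨w, hw, hw'⟩ : ∃ w : ℤ × ℤ, |u.1 - w.1| + |u.2 - w.2| = 1 ∧
        |w.1 - v.1| + |w.2 - v.2| = n := by
      push_cast at h
      rcases lt_trichotomy u.1 v.1 with h1 | h1 | h1
      · exact ⟨(u.1 + 1, u.2), by simp, by
          dsimp only; rw [abs_of_neg (by omega)] at h; rw [abs_of_nonpos (by omega)]; omega⟩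
      · rcases lt_trichotomy u.2 v.2 with h2 | h2 | h2
        · exact ⟨(u.1, u.2 + 1), by simp, by
            dsimp only; rw [abs_of_neg (a := u.2 - v.2) (by omega)] at h
            rw [abs_of_nonpos (a := u.2 + 1 - v.2) (by omega)]; omega⟩
        · simp [h1, h2] at h; omega
        · exact ⟨(u.1, u.2 - 1), by simp, by
            dsimp only; rw [abs_of_pos (a := u.2 - v.2) (by omega)] at h
            rw [abs_of_nonneg (a := u.2 - 1 - v.2) (by omega)]; omega⟩
      · exact ⟨(u.1 - 1, u.2), by simp, by
          dsimp only; rw [abs_of_pos (by omega)] at h; rw [abs_of_nonneg (by omega)]; omega⟩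
    obtain ⟨p, hp⟩ := ih w hw'
    exact ⟨.cons (squareGrid_adj_iff.2 hw) p, by simp [hp]⟩

theorem mem_closedNeighborhood_squareGrid {r : ℕ} {u v : ℤ × ℤ} :
    v ∈ closedNeighborhood squareGrid r u ↔ v - u ∈ ball r := by
  rw [mem_ball, Prod.fst_sub, Prod.snd_sub]
  constructor
  · intro h
    have h : squareGrid.edist v u ≤ (r : ℕ∞) := h
    obtain ⟨p, hp⟩ := SimpleGraph.exists_walk_of_edist_ne_top
      (ne_top_of_le_ne_top (ENat.natCast_ne_top r) h)
    rw [← hp, Nat.cast_le] at h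
    exact (abs_add_abs_le_length p).trans (by exact_mod_cast h)
  · intro h
    obtain ⟨n, hn⟩ := Int.eq_ofNat_of_zero_le
      (add_nonneg (abs_nonneg (v.1 - u.1)) (abs_nonneg (v.2 - u.2)))
    obtain ⟨p, hp⟩ := exists_walk_of_abs_add_abs_eq n v u hn
    have hnr : n ≤ r := by omega
    exact p.edist_le.trans (by rw [hp]; exact_mod_cast hnr)

/-! ### Coverings as solutions of a linear equation -/

/-- The coefficients of the Laurent polynomial of the equation satisfied by coverings: `1` on the
ball, except for `1 - m` at the origin, where `m = b - a`. -/
def coeff (m : ℤ) (u : ℤ × ℤ) : ℤ := if u = 0 then 1 - m else 1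

/-- The function `e` satisfies the covering equation of radius `r` with parameter `m` and constant
right-hand side `κ`: its sum over each ball of radius `r`, minus `m` times its value at the centre,
equals `κ`. -/
def Solves (r : ℕ) (m κ : ℤ) (e : ℤ × ℤ → ℤ) : Prop :=
  ∀ z, ∑ u ∈ ball r, coeff m u * e (z + u) = κ

theorem sum_coeff_mul {r : ℕ} {m : ℤ} (e : ℤ × ℤ → ℤ) (z : ℤ × ℤ) :
    ∑ u ∈ ball r, coeff m u * e (z + u) = ∑ u ∈ ball r, e (z + u) - m * e z := by
  have h0 : (0 : ℤ × ℤ) ∈ ball r := by simp [mem_ball]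
  rw [← Finset.add_sum_erase _ _ h0, ← Finset.add_sum_erase _ (fun u => e (z + u)) h0,
    Finset.sum_congr rfl fun u hu => by rw [coeff, if_neg (Finset.ne_of_mem_erase hu), one_mul]]
  simp only [coeff, if_true, add_zero]
  ring

open Classical in
theorem IsCodeCovering.solves {r b a : ℕ} {S : Set (ℤ × ℤ)}
    (hS : IsCodeCovering squareGrid r b a S) :
    Solves r (b - a) a (fun u => if u ∈ S then 1 else 0) := by
  intro z
  have hcard : (closedNeighborhood squareGrid r z ∩ S).encard =
      (((ball r).filter fun u => z + u ∈ S).card : ℕ∞) := by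
    rw [← Set.encard_coe_eq_coe_finsetCard, ← (add_right_injective z).encard_image
      ((ball r).filter fun u => z + u ∈ S : Finset (ℤ × ℤ))]
    refine congrArg Set.encard (Set.ext fun v => ?_)
    simp only [Set.mem_inter_iff, mem_closedNeighborhood_squareGrid, Set.mem_image,
      Finset.mem_coe, Finset.mem_filter]
    constructor
    · exact fun h => ⟨v - z, ⟨h.1, by simpa using h.2⟩, by simp⟩
    · rintro ⟨u, ⟨h1, h2⟩, rfl⟩
      exact ⟨by simpa using h1, h2⟩
  rw [sum_coeff_mul fun u => if u ∈ S then (1 : ℤ) else 0, Finset.sum_boole]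
  by_cases hz : z ∈ S
  · have := (hS z).1 hz
    rw [hcard, Nat.cast_inj] at this
    simp [hz, this]
  · have := (hS z).2 hz
    rw [hcard, Nat.cast_inj] at this
    simp [hz, this]

theorem Solves.sub {r : ℕ} {m κ κ' : ℤ} {e e' : ℤ × ℤ → ℤ} (h : Solves r m κ e)
    (h' : Solves r m κ' e') : Solves r m (κ - κ') (fun z => e z - e' z) := fun z => by
  simp only [mul_sub, Finset.sum_sub_distrib, h z, h' z]

theorem Solves.comp_add {r : ℕ} {m κ : ℤ} {e : ℤ × ℤ → ℤ} (h : Solves r m κ e) (v : ℤ × ℤ) :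
    Solves r m κ (fun z => e (z + v)) := fun z => by
  simpa only [add_right_comm] using h (z + v)

theorem Solves.comp_addEquiv {r : ℕ} {m κ : ℤ} {e : ℤ × ℤ → ℤ} (h : Solves r m κ e)
    (σ : ℤ × ℤ ≃+ ℤ × ℤ) (hσ : ∀ u, σ u ∈ ball r ↔ u ∈ ball r) :
    Solves r m κ (fun z => e (σ z)) := fun z => by
  rw [← h (σ z)]
  refine Finset.sum_bij (fun u _ => σ u) (fun u hu => (hσ u).2 hu) (fun _ _ _ _ h => σ.injective h)
    (fun u hu => ⟨σ.symm u, (hσ _).1 (by simpa using hu), by simp⟩) fun u _ => ?_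
  simp [coeff]

/-! ### Bounded solutions are determined by strips -/

/-- With `A = 1 + t + ⋯ + t^r` and `B = 1 + t + ⋯ + t^(r-1)` acting on sequences by the shift `t`,
if `A g = 0` and `A h + B g = 0` with `h` bounded, then `g = 0`. Indeed `A² h = 0`, whence `A h = 0`
as `h` is bounded, and `A - B` is a power of the shift. -/
theorem eq_zero_of_consecutive_lines {r : ℕ} {g h : ℤ → ℤ} (hb : IsBounded h)
    (hg : ∀ i, ∑ x ∈ Finset.range (r + 1), g (i + x) = 0)
    (hh : ∀ i, ∑ x ∈ Finset.range (r + 1), h (i + x) + ∑ x ∈ Finset.range r, g (i + x) = 0)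
    (i : ℤ) : g i = 0 := by
  set G : ℤ → ℤ := fun i => ∑ x ∈ Finset.range (r + 1), h (i + x) with hG
  have hstep : ∀ (k : ℤ → ℤ) (i : ℤ), ∑ x ∈ Finset.range (r + 1), k (i + 1 + x) =
      ∑ x ∈ Finset.range (r + 1), k (i + x) + (k (i + (r + 1)) - k i) := by
    intro k i
    rw [Finset.sum_range_succ, Finset.sum_range_succ']
    push_cast
    simp only [add_zero, add_assoc, add_comm (1 : ℤ)]
    ring
  have hAG : ∀ i, ∑ y ∈ Finset.range (r + 1), G (i + y) = 0 := by
    intro i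
    have hGB : ∀ j, G j = -∑ x ∈ Finset.range r, g (j + x) := fun j =>
      eq_neg_of_add_eq_zero_left (hh j)
    rw [Finset.sum_congr rfl fun (y : ℕ) _ => hGB (i + y),
      Finset.sum_neg_distrib, Finset.sum_comm, neg_eq_zero]
    refine Finset.sum_eq_zero fun x _ => ?_
    rw [← hg (i + x)]
    exact Finset.sum_congr rfl fun y _ => by rw [add_right_comm]
  have hGper : ∀ i, G (i + (r + 1)) = G i := fun i => by
    have := hstep G i
    rw [hAG, hAG] at this
    linarith
  have hGdiff : ∀ i, h (i + (r + 1)) - h i = G (i + 1) - G i := fun i => by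
    have := hstep h i
    simp only [hG]
    linarith
  have hper : ∀ i, h (i + (r + 1)) = h i := hb.periodic_of_diff_periodic fun i => by
    rw [hGdiff, hGdiff, add_right_comm, hGper, hGper]
  have hGconst : ∀ (i : ℤ) (y : ℕ), G (i + y) = G i := by
    intro i y
    induction y with
    | zero => simp
    | succ y ih =>
      have := hGdiff (i + y)
      rw [hper] at this
      push_cast
      rw [← add_assoc]
      linarith
  have hG0 : G i = 0 := by
    have := hAG i
    rw [Finset.sum_congr rfl fun y _ => hGconst i y, Finset.sum_const, Finset.card_range,
      nsmul_eq_mul] at this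
    exact (mul_eq_zero.1 this).resolve_left (by positivity)
  have hG0' : G (i - r) = 0 := by
    have := hGconst (i - r) r
    rw [sub_add_cancel] at this
    rw [← this, hG0]
  have h1 := hh (i - r)
  have h2 := hg (i - r)
  rw [Finset.sum_range_succ, sub_add_cancel] at h2
  change G (i - r) + _ = 0 at h1
  linarith

/-- If `h` vanishes at the points of the ball about `z` outside the two extreme diagonals of that
ball, the covering sum at `z` consists of the sums over these diagonals. For `r ≥ 2` neither of them
passes through the centre. -/
theorem sum_ball_eq_diagonals {r : ℕ} (hr : 2 ≤ r) {m : ℤ} {h : ℤ × ℤ → ℤ} {z : ℤ × ℤ}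
    (h0 : ∀ u ∈ ball r, u.1 + u.2 < r - 1 → h (z + u) = 0) :
    ∑ u ∈ ball r, coeff m u * h (z + u) =
      ∑ x ∈ Finset.range (r + 1), h (z + ((x : ℤ), (r : ℤ) - x)) +
        ∑ x ∈ Finset.range r, h (z + ((x : ℤ), (r : ℤ) - 1 - x)) := by
  set P := (Finset.range (r + 1)).image fun x : ℕ => ((x : ℤ), (r : ℤ) - x)
  set Q := (Finset.range r).image fun x : ℕ => ((x : ℤ), (r : ℤ) - 1 - x)
  have hP : ∀ u ∈ P, u.1 + u.2 = r ∧ 0 ≤ u.1 ∧ 0 ≤ u.2 := by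
    intro u hu
    obtain ⟨x, hx, rfl⟩ := Finset.mem_image.1 hu
    rw [Finset.mem_range] at hx
    dsimp only
    omega
  have hQ : ∀ u ∈ Q, u.1 + u.2 = r - 1 ∧ 0 ≤ u.1 ∧ 0 ≤ u.2 := by
    intro u hu
    obtain ⟨x, hx, rfl⟩ := Finset.mem_image.1 hu
    rw [Finset.mem_range] at hx
    dsimp only
    omega
  have hPQ : Disjoint P Q := Finset.disjoint_left.2 fun u h1 h2 => by
    have := (hP u h1).1
    have := (hQ u h2).1
    omega
  have hsub : P ∪ Q ⊆ ball r := by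
    intro u hu
    rw [mem_ball]
    rcases Finset.mem_union.1 hu with hu | hu
    · obtain ⟨h1, h2, h3⟩ := hP u hu
      rw [abs_of_nonneg h2, abs_of_nonneg h3]
      omega
    · obtain ⟨h1, h2, h3⟩ := hQ u hu
      rw [abs_of_nonneg h2, abs_of_nonneg h3]
      omega
  rw [← Finset.sum_subset hsub, Finset.sum_union hPQ, Finset.sum_image, Finset.sum_image]
  · refine congrArg₂ (· + ·) (Finset.sum_congr rfl fun x _ => ?_)
      (Finset.sum_congr rfl fun x _ => ?_)
    · rw [coeff, if_neg, one_mul]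
      simp only [Prod.ext_iff, Prod.fst_zero, Prod.snd_zero]
      omega
    · rw [coeff, if_neg, one_mul]
      simp only [Prod.ext_iff, Prod.fst_zero, Prod.snd_zero]
      omega
  · intro x _ y _ hxy
    simpa using congrArg Prod.fst hxy
  · intro x _ y _ hxy
    simpa using congrArg Prod.fst hxy
  · intro u hu hu'
    rw [h0 u hu, mul_zero]
    by_contra hlt
    apply hu'
    have hle := mem_ball.1 hu
    rw [Finset.mem_union, Finset.mem_image, Finset.mem_image]
    rcases abs_cases u.1 with ⟨h1, h1'⟩ | ⟨h1, h1'⟩ <;>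
      rcases abs_cases u.2 with ⟨h2, h2'⟩ | ⟨h2, h2'⟩ <;> try omega
    by_cases hs : u.1 + u.2 = r
    · refine Or.inl ⟨u.1.toNat, ?_, ?_⟩
      · rw [Finset.mem_range]
        omega
      · ext <;> simp <;> omega
    · refine Or.inr ⟨u.1.toNat, ?_, ?_⟩
      · rw [Finset.mem_range]
        omega
      · ext <;> simp <;> omega

/-- One step of determinism: a bounded solution of the homogeneous equation that vanishes on a
sufficiently wide strip below the line `α x + β y = K` vanishes on that line. -/
def VanishesBeyondStrips (r : ℕ) (m α β : ℤ) : Prop :=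
  ∀ (K : ℤ) (h : ℤ × ℤ → ℤ), IsBounded h → Solves r m 0 h →
    (∀ z : ℤ × ℤ, K - 2 * r * (|α| + |β|) ≤ α * z.1 + β * z.2 → α * z.1 + β * z.2 < K → h z = 0) →
    ∀ z : ℤ × ℤ, α * z.1 + β * z.2 = K → h z = 0

/-- If the linear form attains its maximum on the ball at one vertex only, the covering equation
expresses the value at that vertex through values further inside. -/
theorem vanishesBeyondStrips_of_lt {r : ℕ} (hr : 2 ≤ r) (m : ℤ) {α β : ℤ} (hβ : 0 ≤ β)
    (hαβ : β < α) : VanishesBeyondStrips r m α β := by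
  intro K h _ hs hstrip z hz
  set v : ℤ × ℤ := ((r : ℤ), 0) with hv
  have hmem : v ∈ ball r := by simp [mem_ball, hv]
  have hsum := hs (z - v)
  rw [Finset.sum_eq_single_of_mem v hmem, coeff, if_neg, one_mul, sub_add_cancel] at hsum
  · exact hsum
  · simp only [hv, Prod.ext_iff, Prod.fst_zero, Prod.snd_zero]
    omega
  · rintro ⟨x, y⟩ hu hne
    rw [mem_ball] at hu
    dsimp only at hu
    have hα : 0 < α := hβ.trans_lt hαβ
    have hx := neg_abs_le x
    have hy := neg_abs_le y
    have hx' := le_abs_self x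
    have hy' := le_abs_self y
    have hy0 := abs_nonneg y
    have hr0 : (0 : ℤ) ≤ r := by positivity
    rw [hstrip, mul_zero]
    · simp only [hv, Prod.fst_add, Prod.snd_add, Prod.fst_sub, Prod.snd_sub]
      rw [abs_of_pos hα, abs_of_nonneg hβ]
      nlinarith [mul_nonneg hα.le hr0, mul_nonneg hβ hr0, abs_nonneg x]
    · simp only [hv, Prod.fst_add, Prod.snd_add, Prod.fst_sub, Prod.snd_sub]
      suffices α * x + β * y < α * r by linarith
      by_cases h0 : y = 0
      · subst h0
        have : x ≠ r := fun hxr => hne (by rw [hv, hxr])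
        have : x < r := by
          simp only [abs_zero, add_zero] at hu
          omega
        nlinarith
      · have : 0 < |y| := abs_pos.2 h0
        nlinarith [mul_le_mul_of_nonneg_left hu hα.le]

/-- If the linear form is constant along an edge of the ball, two consecutive diagonals are needed,
and `eq_zero_of_consecutive_lines` applies to them. -/
theorem vanishesBeyondStrips_diagonal {r : ℕ} (hr : 2 ≤ r) (m : ℤ) {α : ℤ} (hα : 0 < α) :
    VanishesBeyondStrips r m α α := by
  intro K h hb hs hstrip z hz
  set s : ℤ := z.1 + z.2 with hsdef
  have hK : K = α * s := by rw [← hz, hsdef]; ring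
  have hr0 : (2 : ℤ) ≤ r := by exact_mod_cast hr
  have hzero : ∀ w : ℤ × ℤ, s - 2 * r ≤ w.1 + w.2 → w.1 + w.2 < s → h w = 0 := by
    intro w h1 h2
    apply hstrip
    · rw [hK, abs_of_pos hα, ← mul_add]
      nlinarith
    · rw [hK, ← mul_add]
      exact mul_lt_mul_of_pos_left h2 hα
  have hlow : ∀ u ∈ ball r, -(r : ℤ) ≤ u.1 + u.2 := fun u hu => by
    have := mem_ball.1 hu
    linarith [neg_abs_le u.1, neg_abs_le u.2]
  have hline : ∀ (t i : ℤ), s ≤ t → t ≤ s + 1 →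
      ∑ x ∈ Finset.range (r + 1), h (i + x, t - (i + x)) +
        ∑ x ∈ Finset.range r, h (i + x, t - 1 - (i + x)) = 0 := by
    intro t i h1 h2
    rw [← hs (i, t - r - i), sum_ball_eq_diagonals hr]
    · refine congrArg₂ (· + ·) (Finset.sum_congr rfl fun x _ => congrArg h ?_)
        (Finset.sum_congr rfl fun x _ => congrArg h ?_) <;> ext <;> simp <;> ring
    · intro u hu hlt
      have := hlow u hu
      apply hzero <;> simp only [Prod.fst_add, Prod.snd_add] <;> linarith
  have hfin := eq_zero_of_consecutive_lines (r := r) (g := fun i => h (i, s - i))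
    (h := fun i => h (i, s + 1 - i)) (by obtain ⟨B, hB⟩ := hb; exact ⟨B, fun i => hB _⟩)
    (fun i => by
      have := hline s i le_rfl (by linarith)
      rwa [Finset.sum_eq_zero (s := Finset.range r), add_zero] at this
      intro x _
      apply hzero <;> dsimp only <;> linarith)
    (fun i => by
      have := hline (s + 1) i (by linarith) le_rfl
      simpa only [add_sub_cancel_right] using this) z.1
  simpa [hsdef] using hfin

theorem VanishesBeyondStrips.swap {r : ℕ} {m α β : ℤ} (H : VanishesBeyondStrips r m α β) :
    VanishesBeyondStrips r m β α := by
  intro K h hb hs hstrip z hz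
  have := H K (fun z => h z.swap) (by obtain ⟨B, hB⟩ := hb; exact ⟨B, fun i => hB _⟩)
    (hs.comp_addEquiv AddEquiv.prodComm fun u => by simp [mem_ball, add_comm])
    (fun w h1 h2 => hstrip _ (by simpa [add_comm] using h1) (by simpa [add_comm] using h2)) z.swap
    (by simpa [add_comm] using hz)
  simpa using this

theorem VanishesBeyondStrips.neg_left {r : ℕ} {m α β : ℤ} (H : VanishesBeyondStrips r m α β) :
    VanishesBeyondStrips r m (-α) β := by
  intro K h hb hs hstrip z hz
  have := H K (fun z => h (-z.1, z.2)) (by obtain ⟨B, hB⟩ := hb; exact ⟨B, fun i => hB _⟩)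
    (hs.comp_addEquiv ((AddEquiv.neg ℤ).prodCongr (AddEquiv.refl ℤ)) fun u => by
      rw [mem_ball, mem_ball]
      exact iff_of_eq (congrArg (· + |u.2| ≤ (r : ℤ)) (abs_neg u.1)))
    (fun w h1 h2 => hstrip _ (by simpa using h1) (by simpa using h2)) (-z.1, z.2)
    (by simpa using hz)
  simpa using this

theorem vanishesBeyondStrips {r : ℕ} (hr : 2 ≤ r) (m : ℤ) {α β : ℤ} (h : (α, β) ≠ 0) :
    VanishesBeyondStrips r m α β := by
  have nonneg_of_le : ∀ α β : ℤ, 0 ≤ β → β ≤ α → (α, β) ≠ 0 → VanishesBeyondStrips r m α β := by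
    intro α β h1 h2 h3
    rcases h2.lt_or_eq with h2 | rfl
    · exact vanishesBeyondStrips_of_lt hr m h1 h2
    · exact vanishesBeyondStrips_diagonal hr m (h1.lt_of_ne fun h => h3 (by simp [← h]))
  have nonneg : ∀ α β : ℤ, 0 ≤ α → 0 ≤ β → (α, β) ≠ 0 → VanishesBeyondStrips r m α β := by
    intro α β h1 h2 h3
    rcases le_total β α with h | h
    · exact nonneg_of_le α β h2 h h3
    · exact (nonneg_of_le β α h1 h fun h0 => h3 (by simp_all)).swap
  have nonneg_right : ∀ α β : ℤ, 0 ≤ β → (α, β) ≠ 0 → VanishesBeyondStrips r m α β := by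
    intro α β h1 h2
    rcases le_total 0 α with h | h
    · exact nonneg α β h h1 h2
    · simpa using (nonneg (-α) β (by linarith) h1 (by simpa using h2)).neg_left
  rcases le_total 0 β with h1 | h1
  · exact nonneg_right α β h1 h
  · simpa using (nonneg_right α (-β) (by linarith) (by simpa using h)).swap.neg_left.swap

/-- A bounded solution of the homogeneous equation that vanishes on a wide strip vanishes. -/
theorem eq_zero_of_vanishes_on_strip {r : ℕ} (hr : 2 ≤ r) {m α β : ℤ} (hαβ : (α, β) ≠ 0)
    {h : ℤ × ℤ → ℤ} (hb : IsBounded h) (hs : Solves r m 0 h)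
    (h0 : ∀ z : ℤ × ℤ, 0 ≤ α * z.1 + β * z.2 → α * z.1 + β * z.2 ≤ 2 * r * (|α| + |β|) → h z = 0)
    (z : ℤ × ℤ) : h z = 0 := by
  have key : ∀ α β : ℤ, (α, β) ≠ 0 → ∀ L : ℤ, (∀ z : ℤ × ℤ, L ≤ α * z.1 + β * z.2 →
      α * z.1 + β * z.2 ≤ L + 2 * r * (|α| + |β|) → h z = 0) →
      ∀ z : ℤ × ℤ, L ≤ α * z.1 + β * z.2 → h z = 0 := by
    intro α β hne L hL
    have hW : (0 : ℤ) ≤ 2 * r * (|α| + |β|) := by positivity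
    have : ∀ (n : ℕ) (z : ℤ × ℤ), L ≤ α * z.1 + β * z.2 →
        α * z.1 + β * z.2 ≤ L + 2 * r * (|α| + |β|) + n → h z = 0 := by
      intro n
      induction n with
      | zero => simpa using hL
      | succ n ih =>
        intro z h1 h2
        push_cast at h2
        rcases le_or_gt (α * z.1 + β * z.2) (L + 2 * r * (|α| + |β|) + n) with h3 | h3
        · exact ih z h1 h3
        · exact vanishesBeyondStrips hr m hne _ h hb hs
            (fun w h4 h5 => ih w (by linarith) (by linarith)) z rfl
    intro z hz
    exact this (α * z.1 + β * z.2 - L).toNat z hz (by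
      have := Int.self_le_toNat (α * z.1 + β * z.2 - L)
      linarith)
  rcases le_total 0 (α * z.1 + β * z.2) with h1 | h1
  · exact key α β hαβ 0 (by simpa using h0) z h1
  · refine key (-α) (-β) (by simpa using hαβ) (-(2 * r * (|α| + |β|))) (fun w h2 h3 => ?_) z ?_
    · rw [abs_neg, abs_neg] at h3
      exact h0 w (by linarith) (by linarith)
    · have hW : (0 : ℤ) ≤ 2 * r * (|α| + |β|) := by positivity
      linarith

/-! ### From one period to two -/

/-- Some positive multiple of every vector is a period of `e`, with a common factor `n`; for
functions on `ℤ²` this says that there are two linearly independent periods. -/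
def IsFullyPeriodic (e : ℤ × ℤ → ℤ) : Prop :=
  ∃ n : ℕ, 0 < n ∧ ∀ w z, e (z + n • w) = e z

theorem eq_of_zsmul_period {e : ℤ × ℤ → ℤ} {v : ℤ × ℤ} (h : ∀ z, e (z + v) = e z) (k : ℤ)
    (z : ℤ × ℤ) : e (z + k • v) = e z := by
  have hp : Function.Periodic e v := h
  exact hp.zsmul k z

/-- A bounded solution of the covering equation with a period `v ≠ 0` is fully periodic. Up to
translation by `v`, a strip parallel to `v` has finitely many cells, so two of the translates of `e`
across the strip agree on it, and a solution is determined by its values on the strip. -/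
theorem IsBounded.isFullyPeriodic_of_period {r : ℕ} (hr : 2 ≤ r) {m κ : ℤ} {e : ℤ × ℤ → ℤ}
    (hb : IsBounded e) (hs : Solves r m κ e) {v : ℤ × ℤ} (hv : v ≠ 0)
    (hper : ∀ z, e (z + v) = e z) : IsFullyPeriodic e := by
  obtain ⟨p, q⟩ := v
  have hn : 0 < p ^ 2 + q ^ 2 := by
    rcases eq_or_ne p 0 with rfl | hp
    · have : q ≠ 0 := fun hq => hv (by rw [hq]; rfl)
      positivity
    · positivity
  set W : ℤ := 2 * r * (|q| + |-p|)
  -- Adding `v` preserves `q x - p y` and adds `p² + q²` to `p x + q y`, so every cell of the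
  -- strip has a translate by a multiple of `v` in the finite set `cells`.
  set cells : Set (ℤ × ℤ) := {z | (q * z.1 + -p * z.2 ∈ Set.Icc 0 W) ∧
    (p * z.1 + q * z.2 ∈ Set.Ico 0 (p ^ 2 + q ^ 2))} with hcells
  have hfin : cells.Finite := by
    have himg : ((fun z : ℤ × ℤ => (q * z.1 + -p * z.2, p * z.1 + q * z.2)) ⁻¹'
        (Set.Icc 0 W ×ˢ Set.Ico 0 (p ^ 2 + q ^ 2))).Finite := by
      refine Set.Finite.preimage (Function.Injective.injOn fun z w h => ?_)
        ((Set.finite_Icc _ _).prod (Set.finite_Ico _ _))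
      obtain ⟨h1, h2⟩ := Prod.ext_iff.1 h
      dsimp only at h1 h2
      ext
      · exact mul_left_cancel₀ hn.ne' (by linear_combination q * h1 + p * h2)
      · exact mul_left_cancel₀ hn.ne' (by linear_combination -p * h1 + q * h2)
    exact himg.subset fun z hz => hz
  obtain ⟨B, hB⟩ := hb
  have := hfin.to_subtype
  let pattern : ℕ → cells → Set.Icc (-B) B := fun k z =>
    ⟨e (z + (k : ℤ) • (q, -p)), abs_le.1 (hB _)⟩
  obtain ⟨k, l, hkl, heq⟩ := Finite.exists_ne_map_eq_of_infinite pattern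
  have hdiff : ∀ z, e (z + (k : ℤ) • (q, -p)) - e (z + (l : ℤ) • (q, -p)) = 0 := by
    refine eq_zero_of_vanishes_on_strip hr (m := m) (α := q) (β := -p) ?_
      ⟨B + B, fun z => (abs_sub _ _).trans (add_le_add (hB _) (hB _))⟩ ?_ fun z h1 h2 => ?_
    · intro h
      obtain ⟨h1, h2⟩ := Prod.ext_iff.1 h
      exact hv (Prod.ext (neg_eq_zero.1 h2) h1)
    · simpa using (hs.comp_add ((k : ℤ) • (q, -p))).sub (hs.comp_add ((l : ℤ) • (q, -p)))
    · set s : ℤ := (p * z.1 + q * z.2) / (p ^ 2 + q ^ 2)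
      have hmod := Int.emod_add_mul_ediv (p * z.1 + q * z.2) (p ^ 2 + q ^ 2)
      have hmod1 := Int.emod_nonneg (p * z.1 + q * z.2) hn.ne'
      have hmod2 := Int.emod_lt_of_pos (p * z.1 + q * z.2) hn
      have hmem : z + (-s) • (p, q) ∈ cells := by
        refine ⟨⟨?_, ?_⟩, ⟨?_, ?_⟩⟩ <;>
          simp only [Prod.fst_add, Prod.snd_add, Prod.smul_mk, smul_eq_mul]
        · linarith
        · linarith
        · linarith
        · linarith
      have h3 := congrArg Subtype.val (congrFun heq ⟨_, hmem⟩)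
      simp only [pattern] at h3
      rw [add_right_comm, eq_of_zsmul_period hper, add_right_comm,
        eq_of_zsmul_period hper] at h3
      rw [h3, sub_self]
  have hper' : ∀ z, e (z + ((k : ℤ) - l) • (q, -p)) = e z := by
    intro z
    have := hdiff (z - (l : ℤ) • (q, -p))
    rw [sub_add_cancel, sub_eq_zero] at this
    rw [← this, sub_smul]
    congr 1
    abel
  have hkl' : ((k : ℤ) - l) ≠ 0 := sub_ne_zero.2 (by exact_mod_cast hkl)
  refine ⟨(((k : ℤ) - l) * (p ^ 2 + q ^ 2)).natAbs,
    Int.natAbs_pos.2 (mul_ne_zero hkl' hn.ne'), fun w z => ?_⟩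
  have hall : ∀ w z, e (z + (((k : ℤ) - l) * (p ^ 2 + q ^ 2)) • w) = e z := by
    intro w z
    -- `p² + q²` is the index of the lattice spanned by `(p, q)` and `(q, -p)`.
    have hw : (((k : ℤ) - l) * (p ^ 2 + q ^ 2)) • w =
        (((k : ℤ) - l) * (p * w.1 + q * w.2)) • (p, q) +
          (q * w.1 - p * w.2) • (((k : ℤ) - l) • (q, -p)) := by
      ext <;> simp <;> ring
    rw [hw, ← add_assoc, eq_of_zsmul_period hper', eq_of_zsmul_period hper]
  rcases Int.natAbs_eq (((k : ℤ) - l) * (p ^ 2 + q ^ 2)) with h | h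
  · rw [← natCast_zsmul, ← h, hall]
  · rw [← natCast_zsmul, ← hall w (z + _), add_assoc, ← add_smul]
    conv_lhs => rw [h]
    simp

/-- If the difference of a bounded solution in some direction is fully periodic, so is the solution:
boundedness makes a multiple of the direction a period. -/
theorem IsBounded.isFullyPeriodic_of_diff {r : ℕ} (hr : 2 ≤ r) {m κ : ℤ} {e : ℤ × ℤ → ℤ}
    (hb : IsBounded e) (hs : Solves r m κ e) {v : ℤ × ℤ} (hv : v ≠ 0)
    (hd : IsFullyPeriodic fun z => e (z + v) - e z) : IsFullyPeriodic e := by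
  obtain ⟨n, hn, hper⟩ := hd
  have htel : ∀ (k : ℕ) (z : ℤ × ℤ), e (z + k • v) - e z =
      ∑ j ∈ Finset.range k, (e (z + j • v + v) - e (z + j • v)) := by
    intro k z
    have := Finset.sum_range_sub (fun j => e (z + j • v)) k
    rw [zero_smul, add_zero] at this
    rw [← this]
    exact Finset.sum_congr rfl fun j _ => by rw [succ_nsmul, add_assoc]
  refine hb.isFullyPeriodic_of_period hr hs (v := n • v) (smul_ne_zero hn.ne' hv)
    (hb.periodic_of_diff_periodic fun z => ?_)
  rw [htel, htel]
  exact Finset.sum_congr rfl fun j _ => by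
    rw [add_right_comm z]
    exact hper v _

theorem Solves.shiftAction_binomial {r : ℕ} {m κ : ℤ} {e : ℤ × ℤ → ℤ} (hs : Solves r m κ e)
    (v : ℤ × ℤ) : Solves r m 0 (shiftAction ℤ (ℤ × ℤ) (single v 1 - 1) e) := by
  have : shiftAction ℤ (ℤ × ℤ) (single v 1 - 1) e = fun z => e (z + v) - e z :=
    funext (shiftAction_single_sub_one v e)
  rw [this, ← sub_self κ]
  exact (hs.comp_add v).sub hs

/-- A bounded solution annihilated by a product of binomials `X^v - 1` with `v ≠ 0` is fully
periodic; the factors are removed one at a time. -/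
theorem IsBounded.isFullyPeriodic_of_prod_annihilator {r : ℕ} (hr : 2 ≤ r) {m : ℤ}
    {ι : Type*} (s : Finset ι) (w : ι → ℤ × ℤ) (hw : ∀ i ∈ s, w i ≠ 0) {κ : ℤ}
    {e : ℤ × ℤ → ℤ} (hb : IsBounded e) (hs : Solves r m κ e)
    (h : shiftAction ℤ (ℤ × ℤ) (∏ i ∈ s, (single (w i) (1 : ℤ) - 1)) e = 0) :
    IsFullyPeriodic e := by
  classical
  induction s using Finset.induction_on generalizing e κ with
  | empty =>
    have he : e = 0 := by simpa using h
    exact ⟨1, one_pos, by simp [he]⟩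
  | insert i s hi ih =>
    rw [Finset.prod_insert hi, mul_comm, map_mul, Module.End.mul_apply] at h
    have := ih (fun j hj => hw j (Finset.mem_insert_of_mem hj)) (hb.shiftAction_apply _)
      (hs.shiftAction_binomial (w i)) h
    rw [funext (shiftAction_single_sub_one (w i) e)] at this
    exact hb.isFullyPeriodic_of_diff hr hs (hw i (Finset.mem_insert_self i s)) this

/-- Bounded solutions of the covering equation are fully periodic. The equation need not be
homogeneous, so the annihilator is constructed for a difference of `e`. -/
theorem IsBounded.isFullyPeriodic {r : ℕ} (hr : 2 ≤ r) {m κ : ℤ} {e : ℤ × ℤ → ℤ}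
    (hb : IsBounded e) (hs : Solves r m κ e) : IsFullyPeriodic e := by
  set d := AddMonoidAlgebra.single ((1, 0) : ℤ × ℤ) (1 : ℤ) - 1
  have hbd := hb.shiftAction_apply d
  have hsd : Solves r m 0 (shiftAction ℤ (ℤ × ℤ) d e) := hs.shiftAction_binomial _
  have hu₀ : ((r : ℤ), (0 : ℤ)) ∈ ball r := by simp [mem_ball]
  have hk : coeff m ((r : ℤ), (0 : ℤ)) ≠ 0 := by
    rw [coeff, if_neg]
    · exact one_ne_zero
    · simp only [Prod.ext_iff, Prod.fst_zero, Prod.snd_zero]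
      omega
  obtain ⟨N, hN, hann⟩ := exists_prod_binomial_annihilator hbd hsd hu₀ hk
  have := hbd.isFullyPeriodic_of_prod_annihilator hr _ _
    (fun u hu => smul_ne_zero hN.ne' (sub_ne_zero.2 (Finset.ne_of_mem_erase hu))) hsd hann
  rw [funext (shiftAction_single_sub_one _ e)] at this
  exact hb.isFullyPeriodic_of_diff hr hs (by simp) this

/-! ### Periodicity of coverings -/

theorem IsCodeCovering.isTwoPeriodicCode {r : ℕ} (hr : 2 ≤ r) {b a : ℕ} {S : Set (ℤ × ℤ)}
    (hS : IsCodeCovering squareGrid r b a S) : IsTwoPeriodicCode S := by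
  classical
  obtain ⟨n, hn, hper⟩ := IsBounded.isFullyPeriodic hr
    (e := fun u => if u ∈ S then 1 else 0)
    ⟨1, fun z => by dsimp only; split_ifs <;> simp⟩ hS.solves
  have hiff : ∀ w z : ℤ × ℤ, z + n • w ∈ S ↔ z ∈ S := fun w z => by
    have := hper w z
    dsimp only at this
    split_ifs at this with h1 h2 h2 <;> simp_all
  have htrans : ∀ w : ℤ × ℤ, S = (n • w) +ᵥ S := fun w => by
    ext z
    rw [Set.mem_vadd_set_iff_neg_vadd_mem, vadd_eq_add, ← hiff w (-(n • w) + z)]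
    simp
  refine ⟨n • (1, 0), n • (0, 1), ?_, htrans _, htrans _⟩
  rw [LinearIndependent.pair_iff]
  intro x y h
  simpa [hn.ne'] using h

theorem vadd_closedNeighborhood_zero (r : ℕ) (u : ℤ × ℤ) :
    u +ᵥ closedNeighborhood squareGrid r 0 = closedNeighborhood squareGrid r u := by
  ext v
  rw [Set.mem_vadd_set_iff_neg_vadd_mem, mem_closedNeighborhood_squareGrid,
    mem_closedNeighborhood_squareGrid, sub_zero, vadd_eq_add, neg_add_eq_sub]

end PerfectCovering

theorem mainTheorem5 (r : ℕ) (hr : 2 ≤ r) (b a : ℕ) :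
    (∀ c : PerfectCovering.Configuration (Fin 2),
      PerfectCovering.IsConfigCovering
          (PerfectCovering.closedNeighborhood PerfectCovering.squareGrid r 0) b a c →
        PerfectCovering.IsTwoPeriodicConfig c) ∧
    (∀ S : Set (ℤ × ℤ),
      PerfectCovering.IsCodeCovering PerfectCovering.squareGrid r b a S →
        PerfectCovering.IsTwoPeriodicCode S) := by
  refine ⟨fun c hc => ?_, fun S hS => hS.isTwoPeriodicCode hr⟩
  have hS : PerfectCovering.IsCodeCovering PerfectCovering.squareGrid r b a {u | c u = 1} := by
    intro u
    have h := hc u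
    rw [PerfectCovering.vadd_closedNeighborhood_zero] at h
    exact ⟨h.1, fun hu => h.2 (by
      have hu : c u ≠ 1 := hu
      omega)⟩
  obtain ⟨t₁, t₂, hli, h1, h2⟩ := hS.isTwoPeriodicCode hr
  have htrans : ∀ t : ℤ × ℤ, {u | c u = 1} = t +ᵥ {u | c u = 1} →
      PerfectCovering.translate t c = c := by
    intro t ht
    ext1 u
    have hiff : c u = 1 ↔ c (u - t) = 1 := by
      have := Set.ext_iff.1 ht u
      rwa [Set.mem_vadd_set_iff_neg_vadd_mem, vadd_eq_add, neg_add_eq_sub] at this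
    change c (u - t) = c u
    omega
  exact ⟨t₁, t₂, hli, htrans t₁ h1, htrans t₂ h2⟩
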